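/- Let $\mathbb K$ be a field, let $n\ge 1$, and let $R=\mathbb K[x_0,\dots,x_n]$ with the standard grading. Let $a,b,s$ be positive integers with $s\ge n+1$ and $b(s-n)+1\le a\le sb$, and put $$c_0=s-\left\lfloor\frac{a-1}{b}\right\rfloor,\qquad \mu_a^0=a-b(s-c_0).$$ Let $\mathcal F=\{f_1,\dots,f_s\}$ be forms in $R$ of a common degree $d$ that are generic, i.e. any at most $n+1$ of them (with distinct indices) form an $R$-regular sequence. Let $$I=I_a(\mathcal F^b)=\left\langle f_1^{e_1}\cdots f_s^{e_s} : 0\le e_i\le b \text{ for all } i,\ \textstyle\sum_i e_i=a\right\rangle .$$ For an ideal $J$ of $R$ and a positive integer $m$ let $J^{(m)_*}=\bigcap_{\mathfrak p\in\operatorname{Min}(J)}(J^mR_{\mathfrak p}\cap R)$, where $\operatorname{Min}(J)$ is the set of minimal primes of $J$; for a nonzero homogeneous ideal $J$ let $\alpha(J)$ be the least degree of a nonzero form in $J$, and set $$\widehat\alpha_*(J)=\lim_{m\to\infty}\frac{\alpha(J^{(m)_*})}{m},\qquad \rho_*(J)=\sup\left\{\frac mr : m,r\ge 1,\ J^{(m)_*}\not\subseteq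 J^r\right\}.$$ Then the limit $\widehat\alpha_*(I)$ exists, the supremum $\rho_*(I)$ is finite, and $$\rho_*(I)=\frac{\alpha(I)}{\widehat\alpha_*(I)}=\frac{a\,c_0}{\mu_a^0\,s}.$$ -/

import Mathlib

open Filter Topology

noncomputable section

/-- A finite family `f` of elements of `R` is `c`-generic if any subfamily of size at most `c + 1`,
listed in any order, is a regular sequence on `R`. -/
def IsGenericFamily {R : Type*} [CommRing R] {s : ℕ} (c : ℕ) (f : Fin s → R) : Prop :=
  ∀ l : List (Fin s), l.Nodup → l.length ≤ c + 1 → RingTheory.Sequence.IsRegular R (l.map f)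

/-- The `a`-fold product ideal `I_a(f₁^{m₁} ⋯ f_s^{m_s})`. -/
def foldProductIdeal {R : Type*} [CommRing R] {s : ℕ} (a : ℕ) (f : Fin s → R) (m : Fin s → ℕ) :
    Ideal R :=
  Ideal.span {g | ∃ e : Fin s → ℕ, (∀ i, e i ≤ m i) ∧ ∑ i, e i = a ∧ g = ∏ i, f i ^ e i}

/-- The `m`-th `*`-symbolic power of `I`: the intersection of `I ^ m R_𝔭 ∩ R` over the minimal
primes `𝔭` of `I`. -/
def starSymbolicPower {R : Type*} [CommRing R] (I : Ideal R) (m : ℕ) : Ideal R :=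
  ⨅ p : PrimeSpectrum R, ⨅ _ : p.asIdeal ∈ I.minimalPrimes,
    ((I ^ m).map (algebraMap R (Localization.AtPrime p.asIdeal))).comap
      (algebraMap R (Localization.AtPrime p.asIdeal))

/-- `α(I)`: the least degree of a nonzero form in the (nonzero homogeneous) ideal `I`. -/
def leastDegree {σ K : Type*} [Field K] (I : Ideal (MvPolynomial σ K)) : ℕ :=
  sInf {k | ∃ g ∈ I, g ≠ 0 ∧ g.IsHomogeneous k}

/-- The sequence `m ↦ α(I^{(m)_*}) / m`. -/
def starWaldschmidtSeq {σ K : Type*} [Field K] (I : Ideal (MvPolynomial σ K)) (m : ℕ) : ℝ :=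
  (leastDegree (starSymbolicPower I m) : ℝ) / m

/-- The `*`-Waldschmidt constant, the limit of `α(I^{(m)_*}) / m` as `m → ∞`. -/
def starWaldschmidt {σ K : Type*} [Field K] (I : Ideal (MvPolynomial σ K)) : ℝ :=
  limUnder atTop (starWaldschmidtSeq I)

/-- The ratios `m / r` of positive integers such that `I^{(m)_*}` is not contained in `I ^ r`. -/
def starResurgenceSet {R : Type*} [CommRing R] (I : Ideal R) : Set ℝ :=
  {q | ∃ m r : ℕ, 0 < m ∧ 0 < r ∧ ¬ starSymbolicPower I m ≤ I ^ r ∧ q = (m : ℝ) / r}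

/-- The `*`-resurgence of `I`. -/
def starResurgence {R : Type*} [CommRing R] (I : Ideal R) : ℝ :=
  sSup (starResurgenceSet I)

end

/-! Write `c = c₀`, `μ = μ_a^0`, so that `a = b (s - c) + μ` with `1 ≤ μ ≤ b` and `1 ≤ c ≤ n`, and
let `J_T` be generated by the `f i` with `i ∈ T`. The minimal primes of `I` are those of the ideals
`J_T` with `|T| = c`, and `I ⊆ J_T ^ μ`. Powers of `J_T` are unmixed
(`IsPermutablyRegular.mem_pow_of_forall_minimalPrimes`), so `I^{(m)_*}` lies in the intersection of
the `J_T ^ (μ m)`. As if the `f i` were variables, this intersection is generated by the products `f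
^ e` whose exponents sum to at least `μ m` over every such `T`
(`IsPermutablyRegular.mem_productIdeal_of_forall_mem_pow`).

The rest concerns exponents. Averaging over the `c` smallest gives `c ∑ e ≥ s μ m`, while `(f₁ ⋯
f_s) ^ v` lies in `I^{(m)_*}` once `c v ≥ μ m`; hence the Waldschmidt constant is `d s μ / c`, and
`α(I) = d a`. A product `f ^ e` lies in `I ^ r` once `∑ min(e i, r b) ≥ r a`, which yields
`I^{(m)_*} ⊆ I ^ r` whenever `a c r < μ s m`. Comparing degrees on powers of `f₁ ⋯ f_s` shows that
this bound is sharp. -/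

/-- Every `f j` is a nonzerodivisor modulo the ideal generated by at most `n` other members of the
family. -/
def IsPermutablyRegular {R ι : Type*} [CommRing R] (n : ℕ) (f : ι → R) : Prop :=
  ∀ (T : Finset ι) (j : ι), j ∉ T → T.card ≤ n → ∀ p : R,
    f j * p ∈ Ideal.span (f '' (T : Set ι)) → p ∈ Ideal.span (f '' (T : Set ι))

/-- The ideal generated by the products `∏ i, f i ^ e i` with `e ∈ A`. -/
def productIdeal {R ι : Type*} [CommRing R] [Fintype ι] (f : ι → R) (A : Set (ι → ℕ)) : Ideal R :=
  Ideal.span ((fun e => ∏ i, f i ^ e i) '' A)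

/-! ### Regularity modulo powers of the generators -/

section Powers

variable {R ι : Type*} [CommRing R]

theorem mem_sup_span_pow_of_mul_mem (J : Ideal R) {x y : R} (hx : ∀ p, x * p ∈ J → p ∈ J)
    (hy : ∀ p, y * p ∈ Ideal.span {x} ⊔ J → p ∈ Ideal.span {x} ⊔ J) (m : ℕ) :
    ∀ p, y * p ∈ Ideal.span {x ^ m} ⊔ J → p ∈ Ideal.span {x ^ m} ⊔ J := by
  induction m with
  | zero => intro p _; simp
  | succ m ih =>
    intro p hp
    obtain ⟨r, z, hz, hrz⟩ := Ideal.mem_span_singleton_sup.1 hp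
    obtain ⟨r', z', hz', hrz'⟩ := Ideal.mem_span_singleton_sup.1
      (hy p (Ideal.mem_span_singleton_sup.2 ⟨r * x ^ m, z, hz, by rw [← hrz]; ring⟩))
    have h1 : y * r' - r * x ^ m ∈ J := by
      apply hx
      have : x * (y * r' - r * x ^ m) = z - y * z' := by
        linear_combination y * hrz' - hrz
      rw [this]
      exact J.sub_mem hz (J.mul_mem_left _ hz')
    obtain ⟨r'', z'', hz'', hrz''⟩ := Ideal.mem_span_singleton_sup.1
      (ih r' (Ideal.mem_span_singleton_sup.2 ⟨r, _, h1, by ring⟩))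
    refine Ideal.mem_span_singleton_sup.2
      ⟨r'', x * z'' + z', J.add_mem (J.mul_mem_left _ hz'') hz', ?_⟩
    linear_combination hrz' + x * hrz''

theorem mem_sup_span_of_pow_mul_mem (J : Ideal R) {x : R} (hx : ∀ p, x * p ∈ J → p ∈ J) (m : ℕ)
    {p : R} (hp : x ^ m * p ∈ Ideal.span {x ^ (m + 1)} ⊔ J) : p ∈ Ideal.span {x} ⊔ J := by
  obtain ⟨r, z, hz, hrz⟩ := Ideal.mem_span_singleton_sup.1 hp
  have hpow : ∀ k q, x ^ k * q ∈ J → q ∈ J := by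
    intro k
    induction k with
    | zero => intro q hq; simpa using hq
    | succ k ih => intro q hq; exact ih q (hx _ (by rwa [← mul_assoc, ← pow_succ']))
  refine Ideal.mem_span_singleton_sup.2 ⟨r, p - r * x, hpow m _ ?_, by ring⟩
  have : x ^ m * (p - r * x) = z := by linear_combination -hrz
  rwa [this]

variable [DecidableEq ι]

theorem span_image_insert (g : ι → R) (k : ι) (T : Finset ι) :
    Ideal.span (g '' ((insert k T : Finset ι) : Set ι)) =
      Ideal.span {g k} ⊔ Ideal.span (g '' (T : Set ι)) := by
  rw [Finset.coe_insert, Set.image_insert_eq, Ideal.span_insert]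

/-- Exponents are raised one index at a time: `S` holds the indices whose exponent may differ from
`1`. Raising the exponent of `f k` needs `f k` regular modulo the remaining powers, and `f j`
regular modulo these together with `f k` itself; both have fewer free exponents. -/
theorem IsPermutablyRegular.pow {n : ℕ} {f : ι → R} (hf : IsPermutablyRegular n f)
    (β : ι → ℕ) : ∀ (T : Finset ι) (j : ι), j ∉ T → T.card ≤ n →
      ∀ p : R, f j * p ∈ Ideal.span ((fun i => f i ^ β i) '' (T : Set ι)) →
        p ∈ Ideal.span ((fun i => f i ^ β i) '' (T : Set ι)) := by
  suffices H : ∀ (S T : Finset ι) (β : ι → ℕ), (∀ i ∈ T, i ∉ S → β i = 1) → ∀ j, j ∉ T →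
      T.card ≤ n → ∀ p : R, f j * p ∈ Ideal.span ((fun i => f i ^ β i) '' (T : Set ι)) →
        p ∈ Ideal.span ((fun i => f i ^ β i) '' (T : Set ι)) from
    fun T => H T T β (fun i hi hi' => absurd hi hi')
  intro S
  induction S using Finset.induction_on with
  | empty =>
    intro T β hβ j hj hT p
    have : (fun i => f i ^ β i) '' (T : Set ι) = f '' (T : Set ι) :=
      Set.image_congr fun i hi => by rw [hβ i hi (by simp), pow_one]
    rw [this]
    exact hf T j hj hT p
  | insert k S hk ih =>
    intro T β hβ j hj hT p
    by_cases hkT : k ∈ T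
    · obtain ⟨T', hkT', rfl⟩ : ∃ T', k ∉ T' ∧ insert k T' = T :=
        ⟨T.erase k, by simp, Finset.insert_erase hkT⟩
      rw [Finset.card_insert_of_notMem hkT'] at hT
      simp only [Finset.mem_insert, not_or] at hj hβ
      rw [span_image_insert]
      have h1 : ∀ i ∈ T', i ∉ S → β i = 1 := fun i hi hiS =>
        hβ i (Or.inr hi) ⟨fun h => hkT' (h ▸ hi), hiS⟩
      refine mem_sup_span_pow_of_mul_mem _ (ih T' β h1 k hkT' (by omega)) ?_ (β k) p
      have h2 : Ideal.span {f k} ⊔ Ideal.span ((fun i => f i ^ β i) '' (T' : Set ι)) =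
          Ideal.span ((fun i => f i ^ Function.update β k 1 i) '' ((insert k T' : Finset ι) : Set ι)) := by
        rw [span_image_insert]
        congr 2
        · simp
        · refine Set.image_congr fun i hi => ?_
          rw [Function.update_of_ne]
          rintro rfl
          exact hkT' hi
      rw [h2]
      refine ih (insert k T') _ (fun i hi hiS => ?_) j (by simp [hj]) ?_
      · by_cases hik : i = k
        · simp [hik]
        · rw [Function.update_of_ne hik]
          exact h1 i (by simpa [hik] using hi) hiS
      · rw [Finset.card_insert_of_notMem hkT']; exact hT
    · refine ih T β (fun i hi hiS => hβ i hi ?_) j hj hT p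
      simp only [Finset.mem_insert, not_or]
      exact ⟨fun h => hkT (h ▸ hi), hiS⟩

theorem IsPermutablyRegular.mem_span_of_prod_mul_mem {n : ℕ} {f : ι → R}
    (hf : IsPermutablyRegular n f) (T : Finset ι) (hT : T.card ≤ n) (α : ι → ℕ) {p : R}
    (hp : (∏ i ∈ T, f i ^ α i) * p ∈ Ideal.span ((fun i => f i ^ (α i + 1)) '' (T : Set ι))) :
    p ∈ Ideal.span (f '' (T : Set ι)) := by
  suffices H : ∀ S ⊆ T, ∀ p, (∏ i ∈ S, f i ^ α i) * p ∈
      Ideal.span ((fun i => f i ^ (if i ∈ S then α i + 1 else 1)) '' (T : Set ι)) →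
        p ∈ Ideal.span (f '' (T : Set ι)) by
    refine H T subset_rfl p ?_
    have : (fun i => f i ^ (if i ∈ T then α i + 1 else 1)) '' (T : Set ι) =
      (fun i => f i ^ (α i + 1)) '' (T : Set ι) :=
        Set.image_congr fun i hi => by rw [if_pos (Finset.mem_coe.1 hi)]
    rwa [this]
  intro S
  induction S using Finset.induction_on with
  | empty => intro _ p hp; simpa using hp
  | insert k S hk ih =>
    intro hS p hp
    have hkT : k ∈ T := hS (Finset.mem_insert_self _ _)
    refine ih (fun i hi => hS (Finset.mem_insert_of_mem hi)) p ?_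
    obtain ⟨T', hkT', rfl⟩ : ∃ T', k ∉ T' ∧ insert k T' = T :=
      ⟨T.erase k, by simp, Finset.insert_erase hkT⟩
    rw [Finset.card_insert_of_notMem hkT'] at hT
    rw [Finset.prod_insert hk, mul_assoc, span_image_insert, if_pos (Finset.mem_insert_self _ _)]
      at hp
    have h1 : (fun i => f i ^ (if i ∈ insert k S then α i + 1 else 1)) '' (T' : Set ι) =
        (fun i => f i ^ (if i ∈ S then α i + 1 else 1)) '' (T' : Set ι) := by
      refine Set.image_congr fun i hi => ?_
      have : i ≠ k := by rintro rfl; exact hkT' hi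
      simp [this]
    rw [h1] at hp
    rw [span_image_insert, if_neg hk, pow_one]
    exact mem_sup_span_of_pow_mul_mem _ (hf.pow _ T' k hkT' (by omega)) _ hp

end Powers

/-! ### Quasi-regularity and powers of `J_T` -/

section Products

variable {R ι : Type*} [CommRing R] [Fintype ι]

theorem prod_pow_mem_productIdeal (f : ι → R) {A : Set (ι → ℕ)} {e e' : ι → ℕ} (he : e ∈ A)
    (hle : e ≤ e') : ∏ i, f i ^ e' i ∈ productIdeal f A := by
  have : ∏ i, f i ^ e' i = (∏ i, f i ^ (e' i - e i)) * ∏ i, f i ^ e i := by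
    rw [← Finset.prod_mul_distrib]
    exact Finset.prod_congr rfl fun i _ => by rw [← pow_add, Nat.sub_add_cancel (hle i)]
  rw [this]
  exact Ideal.mul_mem_left _ _ (Ideal.subset_span ⟨e, he, rfl⟩)

theorem prod_pow_mem_span_pow_succ (f : ι → R) (T : Finset ι) {e α : ι → ℕ}
    (he : ∃ i ∈ T, α i < e i) :
    ∏ i, f i ^ e i ∈ Ideal.span ((fun i => f i ^ (α i + 1)) '' (T : Set ι)) := by
  obtain ⟨i, hi, hlt⟩ := he
  exact Ideal.mem_of_dvd _ ((pow_dvd_pow _ hlt).trans (Finset.dvd_prod_of_mem _ (Finset.mem_univ i)))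
    (Ideal.subset_span ⟨i, hi, rfl⟩)

variable [DecidableEq ι]

theorem prod_pow_mem_span_pow (f : ι → R) (T : Finset ι) (e : ι → ℕ) :
    ∏ i, f i ^ e i ∈ Ideal.span (f '' (T : Set ι)) ^ (∑ i ∈ T, e i) := by
  rw [← Finset.prod_mul_prod_compl T, ← Finset.prod_pow_eq_pow_sum]
  exact Ideal.mul_mem_right _ _ (Ideal.prod_mem_prod fun i hi =>
    Ideal.pow_mem_pow (Ideal.subset_span (Set.mem_image_of_mem f (Finset.mem_coe.2 hi))) _)

theorem span_pow_eq_productIdeal (f : ι → R) (T : Finset ι) (q : ℕ) :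
    Ideal.span (f '' (T : Set ι)) ^ q =
      productIdeal f {e | ∑ i ∈ T, e i = q ∧ ∀ i ∉ T, e i = 0} := by
  apply le_antisymm
  · induction q with
    | zero =>
      rw [pow_zero, Ideal.one_eq_top, top_le_iff, Ideal.eq_top_iff_one]
      exact Ideal.subset_span ⟨0, by simp, by simp⟩
    | succ q ih =>
      rw [pow_succ]
      refine (Ideal.mul_mono_left ih).trans ?_
      rw [productIdeal, Ideal.span_mul_span', Ideal.span_le]
      rintro _ ⟨_, ⟨e, ⟨he, he'⟩, rfl⟩, _, ⟨k, hk, rfl⟩, rfl⟩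
      refine Ideal.subset_span ⟨e + Pi.single k 1, ⟨?_, ?_⟩, ?_⟩
      · simp only [Pi.add_apply, Finset.sum_add_distrib, he]
        simp [Pi.single_apply, Finset.mem_coe.1 hk]
      · intro i hi
        have : i ≠ k := by rintro rfl; exact hi hk
        simp [he' i hi, this]
      · simp only [Pi.add_apply, pow_add, Finset.prod_mul_distrib]
        congr 1
        rw [Finset.prod_eq_single k (fun i _ hi => by simp [hi]) (by simp)]
        simp
  · rw [productIdeal, Ideal.span_le]
    rintro _ ⟨e, ⟨he, -⟩, rfl⟩
    exact he ▸ prod_pow_mem_span_pow f T e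

theorem span_pow_le_span_pow_succ (f : ι → R) (T : Finset ι) (α : ι → ℕ) {q : ℕ}
    (hq : ∑ i ∈ T, α i < q) :
    Ideal.span (f '' (T : Set ι)) ^ q ≤
      Ideal.span ((fun i => f i ^ (α i + 1)) '' (T : Set ι)) := by
  rw [span_pow_eq_productIdeal, productIdeal, Ideal.span_le]
  rintro _ ⟨e, ⟨he, -⟩, rfl⟩
  exact prod_pow_mem_span_pow_succ f T (Finset.exists_lt_of_sum_lt (by rwa [he]))

theorem IsPermutablyRegular.mem_of_prod_compl_mul_mem {n : ℕ} {f : ι → R}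
    (hf : IsPermutablyRegular n f) (T : Finset ι) (hT : T.card ≤ n) (e : ι → ℕ) {p : R}
    (hp : (∏ i ∈ Tᶜ, f i ^ e i) * p ∈ Ideal.span (f '' (T : Set ι))) :
    p ∈ Ideal.span (f '' (T : Set ι)) := by
  suffices H : ∀ S : Finset ι, Disjoint S T → ∀ p, (∏ i ∈ S, f i ^ e i) * p ∈
      Ideal.span (f '' (T : Set ι)) → p ∈ Ideal.span (f '' (T : Set ι)) from
    H Tᶜ disjoint_compl_left p hp
  intro S
  induction S using Finset.induction_on with
  | empty => intro _ p hp; simpa using hp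
  | insert k S hk ih =>
    intro hd p hp
    rw [Finset.disjoint_insert_left] at hd
    refine ih hd.2 p ?_
    rw [Finset.prod_insert hk, mul_assoc] at hp
    generalize e k = m at hp
    induction m with
    | zero => simpa using hp
    | succ m ihm => exact ihm (hf T k hd.1 hT _ (by rwa [← mul_assoc, ← pow_succ']))

/-- Permutably regular families are quasi-regular. -/
theorem IsPermutablyRegular.coeff_mem {n : ℕ} {f : ι → R}
    (hf : IsPermutablyRegular n f) (T : Finset ι) (hT : T.card ≤ n) {q : ℕ} (h : (ι → ℕ) →₀ R)
    (hq : ∀ β ∈ h.support, ∑ i ∈ T, β i = q)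
    (hinj : ∀ β ∈ h.support, ∀ β' ∈ h.support, (∀ i ∈ T, β i = β' i) → β = β')
    (hh : (h.sum fun β r => r * ∏ i, f i ^ β i) ∈ Ideal.span (f '' (T : Set ι)) ^ (q + 1))
    (β : ι → ℕ) : h β ∈ Ideal.span (f '' (T : Set ι)) := by
  by_cases hβ : β ∈ h.support
  swap
  · rw [Finsupp.notMem_support_iff.1 hβ]; exact zero_mem _
  -- Modulo the powers `f i ^ (β i + 1)`, `i ∈ T`, only the `β` term survives: any other exponent of
  -- the same total degree along `T` exceeds `β` somewhere on `T`.
  have h1 := span_pow_le_span_pow_succ f T β (q := q + 1) (by rw [hq β hβ]; exact q.lt_succ_self) hh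
  rw [Finsupp.sum, ← Finset.add_sum_erase _ _ hβ] at h1
  rw [Ideal.add_mem_iff_left] at h1
  · refine hf.mem_of_prod_compl_mul_mem T hT β (hf.mem_span_of_prod_mul_mem T hT β ?_)
    rwa [← mul_assoc, Finset.prod_mul_prod_compl, mul_comm]
  · refine Ideal.sum_mem _ fun β' hβ' => Ideal.mul_mem_left _ _ ?_
    rw [Finset.mem_erase] at hβ'
    apply prod_pow_mem_span_pow_succ
    by_contra! hcon
    apply hβ'.1
    refine hinj _ hβ'.2 _ hβ fun i hi => ?_
    by_contra hne
    have := Finset.sum_lt_sum hcon ⟨i, hi, lt_of_le_of_ne (hcon i hi) hne⟩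
    rw [hq _ hβ'.2, hq _ hβ] at this
    exact lt_irrefl _ this

/-- If `g` has order `q < k`, expand it in products of degree `q`; some coefficient `h` is outside
`J_T`. From `u * g ∈ J_T ^ (q + 1)`, quasi-regularity gives `u * h ∈ J_T`. This reduces unmixedness
of powers to that of `J_T`. -/
theorem IsPermutablyRegular.exists_mul_mem_of_notMem_pow {n : ℕ} {f : ι → R}
    (hf : IsPermutablyRegular n f) (T : Finset ι) (hT : T.card ≤ n) {k : ℕ} {g : R}
    (hg : g ∉ Ideal.span (f '' (T : Set ι)) ^ k) :
    ∃ h ∉ Ideal.span (f '' (T : Set ι)), ∀ u, u * g ∈ Ideal.span (f '' (T : Set ι)) ^ k →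
      u * h ∈ Ideal.span (f '' (T : Set ι)) := by
  set J := Ideal.span (f '' (T : Set ι)) with hJ
  obtain ⟨q, hqk, hgq, hgq'⟩ : ∃ q < k, g ∈ J ^ q ∧ g ∉ J ^ (q + 1) := by
    induction k with
    | zero => simp at hg
    | succ k ih =>
      by_cases h : g ∈ J ^ k
      · exact ⟨k, k.lt_succ_self, h, hg⟩
      · obtain ⟨q, h1, h2⟩ := ih h
        exact ⟨q, h1.trans k.lt_succ_self, h2⟩
  rw [hJ, span_pow_eq_productIdeal, productIdeal, Ideal.span,
    Finsupp.mem_span_image_iff_linearCombination] at hgq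
  obtain ⟨h, hsupp, rfl⟩ := hgq
  rw [Finsupp.mem_supported] at hsupp
  simp only [Finsupp.linearCombination_apply, smul_eq_mul] at *
  have : ∃ β, h β ∉ J := by
    by_contra! hcon
    apply hgq'
    refine Ideal.sum_mem _ fun β hβ => ?_
    rw [pow_succ']
    refine Ideal.mul_mem_mul (hcon β) ?_
    have := prod_pow_mem_span_pow f T β
    rwa [(hsupp hβ).1] at this
  obtain ⟨β, hβ⟩ := this
  refine ⟨h β, hβ, fun u hu => ?_⟩
  have hu' := Ideal.pow_le_pow_right (Nat.succ_le_of_lt hqk) hu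
  have hle : (u • h).support ⊆ h.support := Finsupp.support_smul
  refine hf.coeff_mem T hT (u • h) (q := q) (fun β hβ => (hsupp (hle hβ)).1) ?_ ?_ β
  · intro β hβ β' hβ' heq
    funext i
    by_cases hi : i ∈ T
    · exact heq i hi
    · rw [(hsupp (hle hβ)).2 i hi, (hsupp (hle hβ')).2 i hi]
  · rw [Finsupp.sum_of_support_subset _ hle _ (by simp)]
    rw [Finsupp.sum, Finset.mul_sum] at hu'
    simpa [mul_assoc] using hu'

end Products

/-! ### Exponent weights with ties broken -/

section Weights

theorem Finset.sum_le_sum_of_card_eq {ι : Type*} [DecidableEq ι] {T T' : Finset ι}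
    (hcard : T.card = T'.card) (u : ι → ℕ) (h : ∀ i ∈ T, ∀ l ∉ T, u i ≤ u l) :
    ∑ i ∈ T, u i ≤ ∑ i ∈ T', u i := by
  have h1 := Finset.sum_inter_add_sum_sdiff T T' u
  have h2 := Finset.sum_inter_add_sum_sdiff T' T u
  rw [Finset.inter_comm] at h2
  have h3 : (T \ T').card = (T' \ T).card := Finset.card_sdiff_comm hcard
  have h4 : ∑ i ∈ T \ T', u i ≤ (T \ T').card * (T \ T').sup u := by
    rw [← smul_eq_mul]
    exact Finset.sum_le_card_nsmul _ _ _ fun i hi => Finset.le_sup hi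
  have h5 : (T' \ T).card * (T \ T').sup u ≤ ∑ i ∈ T' \ T, u i := by
    rw [← smul_eq_mul]
    refine Finset.card_nsmul_le_sum _ _ _ fun l hl => Finset.sup_le fun i hi => ?_
    exact h i (Finset.mem_sdiff.1 hi).1 l (Finset.mem_sdiff.1 hl).2
  rw [← h3] at h5
  omega

theorem Finset.le_of_forall_sum_le {ι : Type*} [DecidableEq ι] {T : Finset ι} {u : ι → ℕ}
    (h : ∀ T' : Finset ι, T'.card = T.card → ∑ i ∈ T, u i ≤ ∑ i ∈ T', u i) {i l : ι} (hi : i ∈ T)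
    (hl : l ∉ T) : u i ≤ u l := by
  have hl' : l ∉ T.erase i := fun h => hl (Finset.mem_of_mem_erase h)
  have := h (insert l (T.erase i)) (by
    rw [Finset.card_insert_of_notMem hl', Finset.card_erase_add_one hi])
  rw [Finset.sum_insert hl', ← Finset.add_sum_erase _ _ hi] at this
  omega

variable {s : ℕ}

/-- The weight of an exponent vector along `T`: the total exponent along `T`, with ties between
different sets `T` broken by the binary code of `T`. -/
def exponentWeight (T : Finset (Fin s)) (e : Fin s → ℕ) : ℕ :=
  ∑ i ∈ T, (2 ^ s * e i + 2 ^ (i : ℕ))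

theorem sum_two_pow_lt (T : Finset (Fin s)) : ∑ i ∈ T, 2 ^ (i : ℕ) < 2 ^ s := by
  have := Nat.geomSum_lt (m := 2) (n := s) (s := T.map Fin.valEmbedding) le_rfl (by
    intro k hk
    obtain ⟨i, -, rfl⟩ := Finset.mem_map.1 hk
    exact i.2)
  simpa using this

theorem exponentWeight_eq (T : Finset (Fin s)) (e : Fin s → ℕ) :
    exponentWeight T e = 2 ^ s * ∑ i ∈ T, e i + ∑ i ∈ T, 2 ^ (i : ℕ) := by
  rw [exponentWeight, Finset.sum_add_distrib, Finset.mul_sum]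

/-- Modulo `2 ^ s` the weight is the binary code of the set. -/
theorem eq_of_exponentWeight_eq {T T' : Finset (Fin s)} {e e' : Fin s → ℕ}
    (h : exponentWeight T e = exponentWeight T' e') : T = T' := by
  rw [exponentWeight_eq, exponentWeight_eq] at h
  have h' := congrArg (· % 2 ^ s) h
  simp only [Nat.mul_add_mod, Nat.mod_eq_of_lt (sum_two_pow_lt _)] at h'
  apply Finset.map_injective Fin.valEmbedding
  apply Finset.geomSum_injective (n := 2) le_rfl
  simpa using h'

theorem exponentWeight_mono (T : Finset (Fin s)) : Monotone (exponentWeight T) := fun e e' h =>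
  Finset.sum_le_sum fun i _ => by have := h i; gcongr

/-- The exponent vectors of weight at least `j` along every set of cardinality `c`. -/
def heavyExponents (s c j : ℕ) : Set (Fin s → ℕ) :=
  {e | ∀ T : Finset (Fin s), T.card = c → j ≤ exponentWeight T e}

/-- The least exponent vector that agrees with `α` on `T` and whose weight along `T` is minimal
among the sets of the same cardinality. -/
noncomputable def baseExponent (T : Finset (Fin s)) (α : Fin s → ℕ) (l : Fin s) : ℕ :=
  if l ∈ T then α l else
    sInf {v | ∀ i ∈ T, 2 ^ s * α i + 2 ^ (i : ℕ) ≤ 2 ^ s * v + 2 ^ (l : ℕ)}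

theorem baseExponent_of_mem {T : Finset (Fin s)} (α : Fin s → ℕ) {l : Fin s} (hl : l ∈ T) :
    baseExponent T α l = α l := if_pos hl

theorem baseExponent_congr {T : Finset (Fin s)} {α α' : Fin s → ℕ} (h : ∀ i ∈ T, α i = α' i) :
    baseExponent T α = baseExponent T α' := by
  funext l
  unfold baseExponent
  split_ifs with hl
  · exact h l hl
  · congr 1
    ext v
    simp only [Set.mem_ofPred_eq]
    exact forall₂_congr fun i hi => by rw [h i hi]

theorem exponentWeight_baseExponent (T : Finset (Fin s)) (α : Fin s → ℕ) :
    exponentWeight T (baseExponent T α) = exponentWeight T α :=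
  Finset.sum_congr rfl fun i hi => by rw [baseExponent_of_mem α hi]

theorem le_baseExponent {T : Finset (Fin s)} (α : Fin s → ℕ) {i l : Fin s} (hi : i ∈ T)
    (hl : l ∉ T) :
    2 ^ s * baseExponent T α i + 2 ^ (i : ℕ) ≤ 2 ^ s * baseExponent T α l + 2 ^ (l : ℕ) := by
  -- Nonemptiness is essential: the infimum of the empty set would be `0`.
  have hne : {v | ∀ i ∈ T, 2 ^ s * α i + 2 ^ (i : ℕ) ≤ 2 ^ s * v + 2 ^ (l : ℕ)}.Nonempty := by
    refine ⟨T.sup fun i => 2 ^ s * α i + 2 ^ (i : ℕ), fun i hi => ?_⟩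
    have h1 := Finset.le_sup (f := fun i : Fin s => 2 ^ s * α i + 2 ^ (i : ℕ)) hi
    have h2 := Nat.le_mul_of_pos_left (T.sup fun i : Fin s => 2 ^ s * α i + 2 ^ (i : ℕ))
      (Nat.two_pow_pos s)
    exact (h1.trans h2).trans (Nat.le_add_right _ _)
  have := Nat.sInf_mem hne i hi
  rw [baseExponent_of_mem α hi]
  simpa only [baseExponent, if_neg hl] using this

theorem baseExponent_mem_heavyExponents {T : Finset (Fin s)} (α : Fin s → ℕ) :
    baseExponent T α ∈ heavyExponents s T.card (exponentWeight T α) := by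
  intro T' hT'
  rw [← exponentWeight_baseExponent]
  exact Finset.sum_le_sum_of_card_eq hT'.symm _ fun i hi l hl => le_baseExponent α hi hl

/-- An exchange argument: if `T` has minimal weight, every perturbed exponent on `T` is at most
every one off `T`, which is the condition defining the base vector. -/
theorem baseExponent_le {T : Finset (Fin s)} {α : Fin s → ℕ}
    (h : α ∈ heavyExponents s T.card (exponentWeight T α)) : baseExponent T α ≤ α := by
  intro l
  by_cases hl : l ∈ T
  · exact (baseExponent_of_mem α hl).le
  · rw [baseExponent, if_neg hl]
    exact Nat.sInf_le fun i hi => Finset.le_of_forall_sum_le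
      (u := fun i : Fin s => 2 ^ s * α i + 2 ^ (i : ℕ)) (fun T' hT' => h T' hT') hi hl

end Weights

/-! ### Intersections of powers of the ideals `J_T` -/

section Intersection

variable {R : Type*} [CommRing R] {s : ℕ}

/-- At most one `T` can have weight `j`. Modulo the next layer, `g` is a combination of base
products, determined by their exponents on `T` and all of degree `q < k` there. Since `g ∈ J_T ^ (q
+ 1)`, quasi-regularity puts the coefficients in `J_T`; an extra factor `f i`, `i ∈ T`, then lifts
each product to weight above `j`. -/
theorem IsPermutablyRegular.mem_productIdeal_heavyExponents_succ {n : ℕ} {f : Fin s → R}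
    (hf : IsPermutablyRegular n f) {c : ℕ} (hc : c ≤ n) {k j : ℕ} (hj : j < 2 ^ s * k) {g : R}
    (hg : ∀ T : Finset (Fin s), T.card = c → g ∈ Ideal.span (f '' (T : Set (Fin s))) ^ k)
    (hgj : g ∈ productIdeal f (heavyExponents s c j)) :
    g ∈ productIdeal f (heavyExponents s c (j + 1)) := by
  by_cases hT : ∃ T : Finset (Fin s), T.card = c ∧ ∃ e, exponentWeight T e = j
  swap
  · push Not at hT
    convert hgj using 2
    refine Set.Subset.antisymm (fun e he T hT' => (Nat.le_succ j).trans (he T hT'))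
      fun e he T hT' => ?_
    exact Nat.succ_le_of_lt (lt_of_le_of_ne (he T hT') (hT T hT' e).symm)
  obtain ⟨T, rfl, e₀, he₀⟩ := hT
  obtain ⟨q, hq⟩ : ∃ q, ∑ i ∈ T, e₀ i = q := ⟨_, rfl⟩
  rw [exponentWeight_eq, hq] at he₀
  have hcode := sum_two_pow_lt T
  have hsum : ∀ e, exponentWeight T e = j → ∑ i ∈ T, e i = q := by
    intro e he
    rw [← he₀, exponentWeight_eq] at he
    exact Nat.eq_of_mul_eq_mul_left (Nat.two_pow_pos s) (Nat.add_right_cancel he)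
  have hqk : q < k := Nat.lt_of_mul_lt_mul_left (a := 2 ^ s) (by omega)
  have hstrict : ∀ e, j + 1 ≤ exponentWeight T e → q + 1 ≤ ∑ i ∈ T, e i := by
    intro e he
    rw [← he₀, exponentWeight_eq] at he
    exact Nat.lt_of_mul_lt_mul_left (a := 2 ^ s) (by omega)
  set J := Ideal.span (f '' (T : Set (Fin s))) with hJ
  set B : Set (Fin s → ℕ) := baseExponent T '' {α | exponentWeight T α = j} with hB
  have hle : productIdeal f (heavyExponents s T.card j) ≤
      productIdeal f (heavyExponents s T.card (j + 1)) ⊔ productIdeal f B := by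
    conv_lhs => rw [productIdeal]
    rw [Ideal.span_le]
    rintro _ ⟨e, he, rfl⟩
    by_cases hej : exponentWeight T e = j
    · exact Ideal.mem_sup_right (prod_pow_mem_productIdeal f (Set.mem_image_of_mem _ hej)
        (baseExponent_le (by rwa [hej])))
    · refine Ideal.mem_sup_left (Ideal.subset_span ⟨e, fun T' hT' => ?_, rfl⟩)
      refine Nat.succ_le_of_lt (lt_of_le_of_ne (he T' hT') fun h => hej ?_)
      rw [← hq, ← exponentWeight_eq] at he₀
      rw [eq_of_exponentWeight_eq (he₀.trans h), ← h]
  obtain ⟨l, hl, y, hy, rfl⟩ := Submodule.mem_sup.1 (hle hgj)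
  refine Ideal.add_mem _ hl ?_
  have hlJ : l ∈ J ^ (q + 1) := by
    refine (Ideal.span_le.2 ?_ : productIdeal f _ ≤ _) hl
    rintro _ ⟨e, he, rfl⟩
    exact Ideal.pow_le_pow_right (hstrict e (he T rfl)) (prod_pow_mem_span_pow f T e)
  have hyJ : y ∈ J ^ (q + 1) := by
    have := Ideal.pow_le_pow_right (Nat.succ_le_of_lt hqk) (hg T rfl)
    rwa [Ideal.add_mem_iff_right _ hlJ] at this
  rw [productIdeal, Ideal.span, Finsupp.mem_span_image_iff_linearCombination] at hy
  obtain ⟨h, hsupp, rfl⟩ := hy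
  rw [Finsupp.mem_supported] at hsupp
  simp only [Finsupp.linearCombination_apply, smul_eq_mul] at *
  have hweight : ∀ β ∈ h.support, exponentWeight T β = j := by
    intro β hβ
    obtain ⟨α, hα, rfl⟩ := hsupp hβ
    rw [exponentWeight_baseExponent]; exact hα
  have hbase : ∀ β ∈ h.support, baseExponent T β = β := by
    intro β hβ
    obtain ⟨α, hα, rfl⟩ := hsupp hβ
    exact baseExponent_congr fun i hi => baseExponent_of_mem α hi
  have hcoeff := hf.coeff_mem T hc h (fun β hβ => hsum β (hweight β hβ))
    (fun β hβ β' hβ' heq => by rw [← hbase β hβ, ← hbase β' hβ', baseExponent_congr heq]) hyJ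
  refine Ideal.sum_mem _ fun β hβ => ?_
  have hmul : h β * ∏ i, f i ^ β i ∈ J * Ideal.span {∏ i, f i ^ β i} :=
    Ideal.mul_mem_mul (hcoeff β) (Ideal.mem_span_singleton_self _)
  refine (?_ : J * Ideal.span {∏ i, f i ^ β i} ≤ _) hmul
  rw [hJ, Ideal.span_mul_span', Ideal.span_le]
  rintro _ ⟨_, ⟨i, hi, rfl⟩, _, rfl, rfl⟩
  refine Ideal.subset_span ⟨β + Pi.single i 1, ?_, ?_⟩
  · intro T' hT'
    have hmono := exponentWeight_mono T' (show β ≤ β + Pi.single i 1 from le_self_add)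
    by_cases hTT' : T' = T
    · subst hTT'
      rw [← hweight β hβ, exponentWeight_eq, exponentWeight_eq]
      have : ∑ l ∈ T', (β + Pi.single i 1 : Fin s → ℕ) l = ∑ l ∈ T', β l + 1 := by
        simp [Finset.sum_add_distrib, Pi.single_apply, Finset.mem_coe.1 hi]
      rw [this, mul_add]
      have := Nat.two_pow_pos s
      omega
    · have h1 := baseExponent_mem_heavyExponents (T := T) β T' hT'
      rw [hbase β hβ, hweight β hβ] at h1
      have h2 : exponentWeight T' β ≠ j := fun h => hTT'
        (eq_of_exponentWeight_eq (h.trans (hweight β hβ).symm))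
      omega
  · simp only [Pi.add_apply, pow_add, Finset.prod_mul_distrib]
    rw [mul_comm]
    congr 1
    rw [Finset.prod_eq_single i (fun l _ hl => by simp [hl]) (by simp)]
    simp

/-- An intersection of the `k`-th powers of the ideals generated by `c` members of the family is
generated by products of the members of the family. -/
theorem IsPermutablyRegular.mem_productIdeal_of_forall_mem_pow {n : ℕ} {f : Fin s → R}
    (hf : IsPermutablyRegular n f) {c : ℕ} (hc : c ≤ n) {k : ℕ} {g : R}
    (hg : ∀ T : Finset (Fin s), T.card = c → g ∈ Ideal.span (f '' (T : Set (Fin s))) ^ k) :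
    g ∈ productIdeal f {e | ∀ T : Finset (Fin s), T.card = c → k ≤ ∑ i ∈ T, e i} := by
  have H : ∀ j ≤ 2 ^ s * k, g ∈ productIdeal f (heavyExponents s c j) := by
    intro j
    induction j with
    | zero =>
      intro _
      have : (1 : R) ∈ productIdeal f (heavyExponents s c 0) :=
        Ideal.subset_span ⟨0, fun _ _ => Nat.zero_le _, by simp⟩
      rw [(Ideal.eq_top_iff_one _).2 this]
      trivial
    | succ j ih =>
      intro hj
      exact hf.mem_productIdeal_heavyExponents_succ hc hj hg (ih (Nat.le_of_succ_le hj))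
  refine Ideal.span_mono (Set.image_mono fun e he T hT => ?_) (H _ le_rfl)
  have h1 := he T hT
  rw [exponentWeight_eq] at h1
  have h2 := sum_two_pow_lt T
  -- The code of `T` is below `2 ^ s`, so it cannot make up for a missing unit of exponent.
  refine Nat.le_of_lt_succ (Nat.lt_of_mul_lt_mul_left (a := 2 ^ s) ?_)
  rw [Nat.mul_succ]
  omega

end Intersection

/-! ### Associated primes and heights -/

section Noetherian

variable {R : Type*} [CommRing R]

theorem IsGenericFamily.isPermutablyRegular {s n : ℕ} {f : Fin s → R} (hf : IsGenericFamily n f) :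
    IsPermutablyRegular n f := by
  intro T j hj hT p hp
  have h := (hf (T.toList ++ [j]) (List.nodup_append.2 ⟨T.nodup_toList, by simp, by
    simp only [Finset.mem_toList, List.mem_singleton, forall_eq]
    rintro i hi rfl
    exact hj hi⟩) (by simpa using hT)).toIsWeaklyRegular
  rw [List.map_append, RingTheory.Sequence.isWeaklyRegular_append_iff] at h
  have h2 := (RingTheory.Sequence.isWeaklyRegular_singleton_iff _ _).1 h.2
  have hJ : Ideal.ofList (T.toList.map f) = Ideal.span (f '' (T : Set (Fin s))) := by
    rw [Ideal.ofList]
    congr 1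
    ext x
    simp
  rw [isSMulRegular_quotient_iff_mem_of_smul_mem] at h2
  have := h2 p
  simp only [smul_eq_mul, hJ, Ideal.mul_top] at this
  exact this hp

theorem exists_isPrime_forall_mem_iff_mul_mem [IsNoetherianRing R] {J : Ideal R} {h : R}
    (hh : h ∉ J) :
    ∃ P : Ideal R, P.IsPrime ∧ (∃ x, ∀ p, p ∈ P ↔ p * x ∈ J) ∧ ∀ u, u * h ∈ J → u ∈ P := by
  obtain ⟨P, hP, hle⟩ := exists_le_isAssociatedPrime_of_isNoetherianRing R
    (Ideal.Quotient.mk J h) (fun h0 => hh (Ideal.Quotient.eq_zero_iff_mem.1 h0))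
  obtain ⟨hprime, x, hx⟩ := isAssociatedPrime_iff.1 hP
  obtain ⟨x, rfl⟩ := Ideal.Quotient.mk_surjective x
  have key : ∀ u y : R, u ∈ (⊥ : Submodule R (R ⧸ J)).colon {Ideal.Quotient.mk J y} ↔ u * y ∈ J := by
    intro u y
    rw [Submodule.mem_colon_singleton, Submodule.mem_bot, Algebra.smul_def,
      Ideal.Quotient.algebraMap_eq, ← map_mul, Ideal.Quotient.eq_zero_iff_mem]
  exact ⟨P, hprime, ⟨x, fun p => by rw [hx, key]⟩, fun u hu => hle ((key u h).2 hu)⟩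

theorem IsPermutablyRegular.notMem_minimalPrimes {ι : Type*} {n : ℕ} {f : ι → R}
    (hf : IsPermutablyRegular n f) {T : Finset ι} (hT : T.card ≤ n) {j : ι} (hj : j ∉ T)
    {P : Ideal R} (hP : P ∈ (Ideal.span (f '' (T : Set ι))).minimalPrimes) : f j ∉ P := fun hjP => by
  obtain ⟨y, hy, hmul⟩ := Ideal.exists_mul_mem_of_mem_minimalPrimes hP hjP
  exact hy (hf T j hj hT y hmul)

/-- A minimal prime of `J_T` omits `f j` for `j ∉ T`, so each new generator forces a strictly larger
prime. -/
theorem IsPermutablyRegular.card_le_height {ι : Type*} [DecidableEq ι] {n : ℕ} {f : ι → R}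
    (hf : IsPermutablyRegular n f) (T : Finset ι) (hT : T.card ≤ n + 1) (P : PrimeSpectrum R)
    (hP : Ideal.span (f '' (T : Set ι)) ≤ P.asIdeal) : (T.card : ℕ∞) ≤ Order.height P := by
  induction T using Finset.induction_on generalizing P with
  | empty => simp
  | insert j T hj ih =>
    rw [Finset.card_insert_of_notMem hj] at hT ⊢
    rw [span_image_insert, sup_le_iff, Ideal.span_singleton_le_iff_mem] at hP
    obtain ⟨Q, hQ, hQP⟩ := Ideal.exists_minimalPrimes_le hP.2
    have hlt : (⟨Q, hQ.1.1⟩ : PrimeSpectrum R) < P := by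
      refine lt_of_le_of_ne hQP ?_
      rintro rfl
      exact hf.notMem_minimalPrimes (by omega) hj hQ hP.1
    rw [Nat.cast_succ]
    exact (add_le_add_left (ih (by omega) ⟨Q, hQ.1.1⟩ hQ.1.2) 1).trans (Order.height_add_one_le hlt)

end Noetherian

/-! ### Unmixedness over the polynomial ring -/

section Unmixed

open MvPolynomial

variable {K : Type*} [Field K] {n s d : ℕ}

theorem MvPolynomial.IsHomogeneous.mem_pow_idealOfVars {σ : Type*} {g : MvPolynomial σ K} {k : ℕ}
    (hg : g.IsHomogeneous k) : g ∈ idealOfVars σ K ^ k := by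
  rw [mem_pow_idealOfVars_iff]
  intro x hx
  exact (hg.degree_eq_sum_deg_support hx).le

/-- Graded Krull intersection: the component of degree `m` is unaffected by elements of the `(m +
1)`-st power. -/
theorem MvPolynomial.mem_span_of_forall_mem_sup_pow {σ : Type*} {S : Set (MvPolynomial σ K)}
    (hS : ∀ g ∈ S, ∃ k, g.IsHomogeneous k) {x : MvPolynomial σ K}
    (hx : ∀ k, x ∈ Ideal.span S ⊔ idealOfVars σ K ^ k) : x ∈ Ideal.span S := by
  let _ := MvPolynomial.gradedAlgebra (σ := σ) (R := K)
  have hJ : (Ideal.span S).IsHomogeneous (homogeneousSubmodule σ K) :=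
    Ideal.homogeneous_span _ _ hS
  rw [mem_iff_homogeneousComponent_mem hJ]
  intro m
  obtain ⟨y, hy, z, hz, rfl⟩ := Submodule.mem_sup.1 (hx (m + 1))
  rw [map_add]
  refine Ideal.add_mem _ (homogeneousComponent_mem_of_mem hJ hy m) ?_
  have : homogeneousComponent m z = 0 := by
    apply homogeneousComponent_eq_zero'
    intro e he
    have := (mem_pow_idealOfVars_iff _ _).1 hz e he
    omega
  rw [this]
  exact zero_mem _

theorem IsGenericFamily.degree_pos {f : Fin s → MvPolynomial (Fin (n + 1)) K}
    (hf : IsGenericFamily n f) (hdeg : ∀ i, (f i).IsHomogeneous d) (i : Fin s) : 0 < d := by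
  by_contra hd
  obtain rfl : d = 0 := by omega
  have h := (hf [i] (by simp) (by simp)).top_ne_smul
  have h0 : f i ≠ 0 := by
    intro h0
    have := hf.isPermutablyRegular ∅ i (by simp) (by simp) 1 (by simp [h0])
    simp at this
  obtain ⟨r, hr⟩ : ∃ r, f i = C r := ⟨_, totalDegree_eq_zero_iff_eq_C.1
    (Nat.le_zero.1 (hdeg i).totalDegree_le)⟩
  apply h
  have hr0 : r ≠ 0 := by rintro rfl; simp [hr] at h0
  have : Ideal.span {f i} = ⊤ := by
    rw [Ideal.span_singleton_eq_top, hr]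
    exact (isUnit_iff_ne_zero.2 hr0).map C
  simp [Ideal.ofList, this]

variable {f : Fin s → MvPolynomial (Fin (n + 1)) K}

/-- Let `N` be the set of `x` with `P x ⊆ J_T`. Were `N ⊆ (f j) + J_T`, cancelling `f j` would
return the quotient to `N`; iterating, `N` would lie in `J_T` plus every power of the irrelevant
ideal, hence in `J_T`. So some `x ∈ N` avoids `(f j) + J_T`, and an associated prime above its
annihilator contains both `P` and `f j ∉ P`. -/
theorem IsPermutablyRegular.exists_gt_isPrime (hf : IsPermutablyRegular n f)
    (hdeg : ∀ i, (f i).IsHomogeneous d) (hd : 0 < d) (T : Finset (Fin s)) (hT : T.card ≤ n)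
    {j : Fin s} (hj : j ∉ T) {P : Ideal (MvPolynomial (Fin (n + 1)) K)} [hPp : P.IsPrime]
    (hP : ∃ x, ∀ p, p ∈ P ↔ p * x ∈ Ideal.span (f '' (T : Set (Fin s)))) :
    ∃ P' : Ideal (MvPolynomial (Fin (n + 1)) K), P'.IsPrime ∧ P < P' ∧
      ∃ x, ∀ p, p ∈ P' ↔ p * x ∈ Ideal.span (f '' ((insert j T : Finset (Fin s)) : Set (Fin s))) := by
  set J := Ideal.span (f '' (T : Set (Fin s))) with hJ
  obtain ⟨h, hP⟩ := hP
  have hh : h ∉ J := fun hh => hPp.ne_top ((Ideal.eq_top_iff_one _).2 ((hP 1).2 (by rwa [one_mul])))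
  have hN : ∃ x, (∀ p ∈ P, p * x ∈ J) ∧ x ∉ Ideal.span {f j} ⊔ J := by
    by_contra! hcon
    have hpow : ∀ k, ∀ x, (∀ p ∈ P, p * x ∈ J) → x ∈ J ⊔ idealOfVars (Fin (n + 1)) K ^ k := by
      intro k
      induction k with
      | zero => intro x _; simp
      | succ k ih =>
        intro x hx
        obtain ⟨y, z, hz, rfl⟩ := Ideal.mem_span_singleton_sup.1 (hcon x hx)
        have hy := ih y fun p hp => hf T j hj hT _ (by
          have := J.sub_mem (hx p hp) (J.mul_mem_left p hz)
          convert this using 1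
          ring)
        obtain ⟨a, ha, b, hb, rfl⟩ := Submodule.mem_sup.1 hy
        refine Submodule.mem_sup.2 ⟨a * f j + z, J.add_mem (J.mul_mem_right _ ha) hz, b * f j, ?_,
          by ring⟩
        rw [pow_succ]
        refine Ideal.mul_mem_mul hb ?_
        have := Ideal.pow_le_pow_right hd (hdeg j).mem_pow_idealOfVars
        rwa [Nat.succ_eq_add_one, zero_add, pow_one] at this
    refine hh (mem_span_of_forall_mem_sup_pow ?_ fun k => hpow k h fun p hp => (hP p).1 hp)
    rintro _ ⟨i, -, rfl⟩
    exact ⟨d, hdeg i⟩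
  obtain ⟨x, hxP, hx⟩ := hN
  rw [hJ, ← span_image_insert] at hx
  obtain ⟨P', hP', hass, hmem⟩ := exists_isPrime_forall_mem_iff_mul_mem hx
  rw [span_image_insert, ← hJ] at hmem
  refine ⟨P', hP', lt_of_le_of_ne (fun p hp => hmem p (Ideal.mem_sup_right (hxP p hp))) ?_, hass⟩
  rintro rfl
  have : f j ∈ P := hmem _ (Ideal.mem_sup_left
    (Ideal.mul_mem_right _ _ (Ideal.mem_span_singleton_self _)))
  exact hh (hf T j hj hT _ ((hP _).1 this))

theorem IsPermutablyRegular.le_coheight (hf : IsPermutablyRegular n f)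
    (hdeg : ∀ i, (f i).IsHomogeneous d) (hd : 0 < d) (hs : n + 1 ≤ s) (r : ℕ)
    (T : Finset (Fin s)) (hT : T.card + r ≤ n + 1)
    (P : PrimeSpectrum (MvPolynomial (Fin (n + 1)) K))
    (hP : ∃ x, ∀ p, p ∈ P.asIdeal ↔ p * x ∈ Ideal.span (f '' (T : Set (Fin s)))) :
    (r : ℕ∞) ≤ Order.coheight P := by
  induction r generalizing T P with
  | zero => simp
  | succ r ih =>
    obtain ⟨j, hj⟩ : ∃ j, j ∉ T := by
      by_contra! hcon
      have := Finset.card_eq_of_bijective (s := T) (n := s) (fun i hi => ⟨i, hi⟩)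
        (fun a _ => ⟨a, a.2, rfl⟩) (fun i hi => hcon _) (by simp)
      omega
    obtain ⟨P', hP', hlt, hass⟩ := hf.exists_gt_isPrime hdeg hd T (by omega) hj hP
    have := ih (insert j T) (by rw [Finset.card_insert_of_notMem hj]; omega) ⟨P', hP'⟩ hass
    rw [Nat.cast_succ]
    exact (add_le_add_left this 1).trans (Order.coheight_add_one_le hlt)

/-- The ideal generated by at most `n` members of the family is unmixed. -/
theorem IsPermutablyRegular.exists_mem_minimalPrimes (hf : IsPermutablyRegular n f)
    (hdeg : ∀ i, (f i).IsHomogeneous d) (hd : 0 < d) (hs : n + 1 ≤ s)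
    (T : Finset (Fin s)) (hT : T.card ≤ n) {h : MvPolynomial (Fin (n + 1)) K}
    (hh : h ∉ Ideal.span (f '' (T : Set (Fin s)))) :
    ∃ P ∈ (Ideal.span (f '' (T : Set (Fin s)))).minimalPrimes,
      ∀ u, u * h ∈ Ideal.span (f '' (T : Set (Fin s))) → u ∈ P := by
  obtain ⟨P, hP, hass, hmem⟩ := exists_isPrime_forall_mem_iff_mul_mem hh
  have hle : Ideal.span (f '' (T : Set (Fin s))) ≤ P := fun p hp => hmem p (Ideal.mul_mem_right _ _ hp)
  refine ⟨P, ?_, hmem⟩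
  obtain ⟨Q, hQ, hQP⟩ := Ideal.exists_minimalPrimes_le hle
  rcases eq_or_lt_of_le hQP with rfl | hlt
  · exact hQ
  exfalso
  -- If `Q < P`, height at least `|T| + 1` and coheight at least `n + 1 - |T|` at `P` exceed the
  -- dimension `n + 1`.
  have h1 := hf.card_le_height T (by omega) ⟨Q, hQ.1.1⟩ hQ.1.2
  have h2 : Order.height (⟨Q, hQ.1.1⟩ : PrimeSpectrum _) + 1 ≤
    Order.height (⟨P, hP⟩ : PrimeSpectrum _) := Order.height_add_one_le hlt
  have h3 := hf.le_coheight hdeg hd hs (n + 1 - T.card) T (by omega) ⟨P, hP⟩ hass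
  have h4 : ringKrullDim (MvPolynomial (Fin (n + 1)) K) = ((n + 1 : ℕ) : ℕ∞) := by
    rw [MvPolynomial.ringKrullDim_of_isNoetherianRing, ringKrullDim_eq_zero_of_field]
    simp
  rw [ringKrullDim, Order.krullDim_eq_iSup_height_add_coheight_of_nonempty, WithBot.coe_inj] at h4
  have h5 := le_iSup (fun a : PrimeSpectrum (MvPolynomial (Fin (n + 1)) K) =>
    Order.height a + Order.coheight a) ⟨P, hP⟩
  rw [h4] at h5
  have h6 : ((T.card + 1 + (n + 1 - T.card) : ℕ) : ℕ∞) ≤ ((n + 1 : ℕ) : ℕ∞) := by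
    refine le_trans ?_ h5
    push_cast
    exact add_le_add ((add_le_add_left h1 1).trans h2) (by exact_mod_cast h3)
  have := ENat.natCast_le_natCast.1 h6
  omega

/-- Membership in a power of the ideal generated by at most `n` members of the family can be
tested at the minimal primes. -/
theorem IsPermutablyRegular.mem_pow_of_forall_minimalPrimes (hf : IsPermutablyRegular n f)
    (hdeg : ∀ i, (f i).IsHomogeneous d) (hd : 0 < d) (hs : n + 1 ≤ s)
    (T : Finset (Fin s)) (hT : T.card ≤ n) {k : ℕ} {g : MvPolynomial (Fin (n + 1)) K}
    (hg : ∀ P ∈ (Ideal.span (f '' (T : Set (Fin s)))).minimalPrimes,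
      ∃ u ∉ P, u * g ∈ Ideal.span (f '' (T : Set (Fin s))) ^ k) :
    g ∈ Ideal.span (f '' (T : Set (Fin s))) ^ k := by
  by_contra hcon
  obtain ⟨h, hh, hmul⟩ := hf.exists_mul_mem_of_notMem_pow T hT hcon
  obtain ⟨P, hP, hmem⟩ := hf.exists_mem_minimalPrimes hdeg hd hs T hT hh
  obtain ⟨u, hu, hug⟩ := hg P hP
  exact hu (hmem u (hmul u hug))

end Unmixed

/-! ### Integer vectors and averaging -/

section Combinatorics

variable {ι : Type*} [Fintype ι] [DecidableEq ι]

theorem exists_sum_eq_of_le {l u : ι → ℕ} (hlu : l ≤ u) {a : ℕ} (hl : ∑ i, l i ≤ a)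
    (hu : a ≤ ∑ i, u i) : ∃ e, l ≤ e ∧ e ≤ u ∧ ∑ i, e i = a := by
  induction a, hl using Nat.le_induction with
  | base => exact ⟨l, le_rfl, hlu, rfl⟩
  | succ a _ ih =>
    obtain ⟨e, hle, heu, rfl⟩ := ih (Nat.le_of_succ_le hu)
    obtain ⟨i, -, hi⟩ := Finset.exists_lt_of_sum_lt (Nat.lt_of_succ_le hu)
    refine ⟨e + Pi.single i 1, hle.trans le_self_add, fun j => ?_, ?_⟩
    · by_cases hj : j = i
      · subst hj; simpa using hi
      · simpa [hj] using heu j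
    · simp [Finset.sum_add_distrib]

theorem exists_card_eq_forall_le (e : ι → ℕ) {c : ℕ} (hc : c ≤ Fintype.card ι) :
    ∃ T : Finset ι, T.card = c ∧ ∀ i ∈ T, ∀ l ∉ T, e i ≤ e l := by
  obtain ⟨T, hT, hmin⟩ := Finset.exists_min_image (Finset.powersetCard c Finset.univ)
    (fun T => ∑ i ∈ T, e i) (Finset.powersetCard_nonempty.2 hc)
  rw [Finset.mem_powersetCard_univ] at hT
  refine ⟨T, hT, fun i hi l hl => Finset.le_of_forall_sum_le (fun T' hT' => hmin T' ?_) hi hl⟩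
  rw [Finset.mem_powersetCard_univ, hT', hT]

theorem card_mul_sum_le (e : ι → ℕ) (T : Finset ι) (hT : ∀ i ∈ T, ∀ l ∉ T, e i ≤ e l) :
    Fintype.card ι * ∑ i ∈ T, e i ≤ T.card * ∑ i, e i := by
  rw [← Finset.sum_add_sum_compl T, ← Finset.card_add_card_compl T, add_mul, mul_add]
  refine Nat.add_le_add le_rfl ?_
  rw [Finset.mul_sum Tᶜ, ← smul_eq_mul (Tᶜ).card]
  refine Finset.card_nsmul_le_sum _ _ _ fun l hl => ?_
  rw [← smul_eq_mul]
  exact Finset.sum_le_card_nsmul _ _ _ fun i hi => hT i hi l (Finset.mem_compl.1 hl)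

end Combinatorics

/-! ### Fold product ideals: powers and minimal primes -/

section FoldProducts

variable {R : Type*} [CommRing R] {s a b c μ : ℕ}

/-- Peel off one generator at a time: its exponent must lie between `e - r b` and `min b e`. The
rational vector `e / (r + 1)` lies in this box and has sum `a`, so an integral one exists too. -/
theorem prod_pow_mem_foldProductIdeal_pow_of_sum_eq (f : Fin s → R) {r : ℕ} {e : Fin s → ℕ}
    (he : ∀ i, e i ≤ r * b) (hsum : ∑ i, e i = r * a) :
    ∏ i, f i ^ e i ∈ foldProductIdeal a f (fun _ => b) ^ r := by
  induction r generalizing e with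
  | zero => simp
  | succ r ih =>
    have hl : ∑ i, (e i - r * b) ≤ a := by
      refine le_of_mul_le_mul_left (a := r + 1) ?_ r.succ_pos
      rw [← hsum, Finset.mul_sum]
      refine Finset.sum_le_sum fun i _ => ?_
      rcases le_total (e i) (r * b) with h | h
      · simp [Nat.sub_eq_zero_of_le h]
      · obtain ⟨k, hk⟩ := Nat.exists_eq_add_of_le h
        have := he i
        rw [hk] at this ⊢
        rw [Nat.add_sub_cancel_left]
        have hkb : k ≤ b := by linarith
        nlinarith [Nat.mul_le_mul_left r hkb]
    have hu : a ≤ ∑ i, min b (e i) := by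
      refine le_of_mul_le_mul_left (a := r + 1) ?_ r.succ_pos
      rw [← hsum, Finset.mul_sum]
      refine Finset.sum_le_sum fun i _ => ?_
      rcases le_total b (e i) with h | h
      · rw [min_eq_left h]; exact he i
      · rw [min_eq_right h]; exact Nat.le_mul_of_pos_left _ r.succ_pos
    obtain ⟨e', hle, heu, rfl⟩ := exists_sum_eq_of_le (fun i => by
      have := he i
      rw [add_mul, one_mul] at this
      exact le_min (Nat.sub_le_iff_le_add'.2 this) (Nat.sub_le _ _)) hl hu
    have h1 : ∏ i, f i ^ e' i ∈ foldProductIdeal (∑ i, e' i) f (fun _ => b) :=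
      Ideal.subset_span ⟨e', fun i => (heu i).trans (min_le_left _ _), rfl, rfl⟩
    have hee : ∀ i, e' i ≤ e i := fun i => (heu i).trans (min_le_right _ _)
    have h2 : ∏ i, f i ^ (e i - e' i) ∈ foldProductIdeal (∑ i, e' i) f (fun _ => b) ^ r := by
      refine ih (fun i => ?_) ?_
      · have := hle i
        dsimp only at this
        omega
      · rw [Finset.sum_tsub_distrib _ (fun i _ => hee i), hsum, add_mul, one_mul,
          Nat.add_sub_cancel]
    rw [pow_succ]
    convert Ideal.mul_mem_mul h2 h1 using 1
    rw [← Finset.prod_mul_distrib]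
    exact Finset.prod_congr rfl fun i _ => by rw [← pow_add, Nat.sub_add_cancel (hee i)]

theorem prod_pow_mem_foldProductIdeal_pow (f : Fin s → R) {r : ℕ} {e : Fin s → ℕ}
    (hsum : r * a ≤ ∑ i, min (e i) (r * b)) :
    ∏ i, f i ^ e i ∈ foldProductIdeal a f (fun _ => b) ^ r := by
  obtain ⟨e', -, heu, hsum'⟩ := exists_sum_eq_of_le (l := 0)
    (u := fun i => min (e i) (r * b)) (fun i => Nat.zero_le _) (by simp) hsum
  have h1 := prod_pow_mem_foldProductIdeal_pow_of_sum_eq f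
    (fun i => (heu i).trans (min_le_right _ _)) hsum'
  have h2 := prod_pow_mem_productIdeal f (Set.mem_singleton e')
    (fun i => (heu i).trans (min_le_left _ _))
  refine (Ideal.span_le.2 ?_ : productIdeal f {e'} ≤ _) h2
  rintro _ ⟨_, rfl, rfl⟩
  exact h1

theorem foldProductIdeal_le_span_pow (f : Fin s → R) (ha : a = b * (s - c) + μ)
    (T : Finset (Fin s)) (hT : T.card = c) :
    foldProductIdeal a f (fun _ => b) ≤ Ideal.span (f '' (T : Set (Fin s))) ^ μ := by
  rw [foldProductIdeal, Ideal.span_le]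
  rintro _ ⟨e, he, hsum, rfl⟩
  refine Ideal.pow_le_pow_right ?_ (prod_pow_mem_span_pow f T e)
  rw [← Finset.sum_add_sum_compl T, ha] at hsum
  have h : ∑ i ∈ Tᶜ, e i ≤ (Tᶜ).card • b := Finset.sum_le_card_nsmul _ _ _ fun i _ => he i
  rw [Finset.card_compl, Fintype.card_fin, hT, smul_eq_mul, mul_comm] at h
  omega

-- If fewer than `c` members lie in `P`, the others number at least `s - c + 1` and, as `μ ≤ b`,
-- have room for a generator avoiding `P`.
open Classical in
theorem le_card_of_foldProductIdeal_le (f : Fin s → R) (hcs : c ≤ s) (hμb : μ ≤ b)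
    (ha : a = b * (s - c) + μ) (P : Ideal R) [hPp : P.IsPrime]
    (hP : foldProductIdeal a f (fun _ => b) ≤ P) :
    c ≤ (Finset.univ.filter fun i => f i ∈ P).card := by
  by_contra! hlt
  set T := Finset.univ.filter fun i => f i ∈ P with hT
  have hcard := T.card_le_univ
  rw [Fintype.card_fin] at hcard
  have hsum : ∑ i, (if i ∈ T then 0 else b) = b * (s - T.card) := by
    rw [Finset.sum_ite, Finset.sum_const_zero, zero_add, Finset.sum_const, smul_eq_mul, mul_comm,
      Finset.filter_notMem_eq_sdiff, ← Finset.compl_eq_univ_sdiff, Finset.card_compl,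
      Fintype.card_fin]
  have hle : a ≤ ∑ i, (if i ∈ T then 0 else b) := by
    rw [hsum, ha]
    have : b * (s - c + 1) ≤ b * (s - T.card) := Nat.mul_le_mul_left _ (by omega)
    rw [mul_add, mul_one] at this
    omega
  obtain ⟨e, -, heu, hsum'⟩ := exists_sum_eq_of_le (l := 0) (fun i => Nat.zero_le _) (by simp) hle
  have hmem : ∏ i, f i ^ e i ∈ P := hP (Ideal.subset_span ⟨e, fun i => (heu i).trans (by
    dsimp only; split_ifs <;> simp), hsum', rfl⟩)
  obtain ⟨i, -, hi⟩ := (Ideal.IsPrime.prod_mem_iff (p := P)).1 hmem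
  by_cases hiT : i ∈ T
  · have := heu i
    simp only [hiT, if_true, Nat.le_zero] at this
    rw [this, pow_zero] at hi
    exact hPp.ne_top ((Ideal.eq_top_iff_one _).2 hi)
  · exact hiT (Finset.mem_filter.2 ⟨Finset.mem_univ _, hPp.mem_of_pow_mem _ hi⟩)

theorem mem_starSymbolicPower_iff {I : Ideal R} {m : ℕ} {g : R} :
    g ∈ starSymbolicPower I m ↔ ∀ P ∈ I.minimalPrimes, ∃ u ∉ P, u * g ∈ I ^ m := by
  simp only [starSymbolicPower, Ideal.mem_iInf, Ideal.mem_comap]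
  constructor
  · intro h P hP
    obtain ⟨p, rfl⟩ : ∃ p : PrimeSpectrum R, p.asIdeal = P := ⟨⟨P, hP.1.1⟩, rfl⟩
    exact (IsLocalization.algebraMap_mem_map_algebraMap_iff p.asIdeal.primeCompl _ _ _).1 (h p hP)
  · intro h P hP
    rw [IsLocalization.algebraMap_mem_map_algebraMap_iff P.asIdeal.primeCompl]
    exact h _ hP

variable {n : ℕ} {f : Fin s → R}

theorem IsPermutablyRegular.exists_mem_minimalPrimes_span (hf : IsPermutablyRegular n f)
    (hcn : c ≤ n) (hcs : c ≤ s) (hμ : 0 < μ) (hμb : μ ≤ b) (ha : a = b * (s - c) + μ) {P : Ideal R}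
    (hP : P ∈ (foldProductIdeal a f (fun _ => b)).minimalPrimes) :
    ∃ T : Finset (Fin s), T.card = c ∧ ∀ i ∉ T, f i ∉ P := by
  classical
  have hPp := hP.1.1
  obtain ⟨T, hTP, hT⟩ := Finset.exists_subset_card_eq
    (le_card_of_foldProductIdeal_le f hcs hμb ha P hP.1.2)
  refine ⟨T, hT, fun i hi hiP => ?_⟩
  have hle : Ideal.span (f '' (T : Set (Fin s))) ≤ P := by
    rw [Ideal.span_le]
    rintro _ ⟨i, hi, rfl⟩
    exact (Finset.mem_filter.1 (hTP hi)).2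
  obtain ⟨Q, hQ, hQP⟩ := Ideal.exists_minimalPrimes_le hle
  have hPQ : P ≤ Q := hP.2 ⟨hQ.1.1, (foldProductIdeal_le_span_pow f ha T hT).trans
    ((Ideal.pow_le_self hμ.ne').trans hQ.1.2)⟩ hQP
  exact hf.notMem_minimalPrimes (by omega) hi hQ (hPQ hiP)

theorem IsPermutablyRegular.mem_minimalPrimes_foldProductIdeal (hf : IsPermutablyRegular n f)
    (hcn : c ≤ n) (hcs : c ≤ s) (hμ : 0 < μ) (hμb : μ ≤ b) (ha : a = b * (s - c) + μ)
    (T : Finset (Fin s)) (hT : T.card = c) {P : Ideal R}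
    (hP : P ∈ (Ideal.span (f '' (T : Set (Fin s)))).minimalPrimes) :
    P ∈ (foldProductIdeal a f (fun _ => b)).minimalPrimes := by
  classical
  refine ⟨⟨hP.1.1, (foldProductIdeal_le_span_pow f ha T hT).trans
    ((Ideal.pow_le_self hμ.ne').trans hP.1.2)⟩, fun Q hQ hQP => hP.2 ⟨hQ.1, ?_⟩ hQP⟩
  have hQp := hQ.1
  have hcard := le_card_of_foldProductIdeal_le f hcs hμb ha Q hQ.2
  have hsub : (Finset.univ.filter fun i => f i ∈ Q) ⊆ T := by
    intro i hi
    by_contra hiT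
    exact hf.notMem_minimalPrimes (by omega) hiT hP (hQP (Finset.mem_filter.1 hi).2)
  have heq := Finset.eq_of_subset_of_card_le hsub (by omega)
  rw [Ideal.span_le]
  rintro _ ⟨i, hi, rfl⟩
  rw [← heq] at hi
  exact (Finset.mem_filter.1 (Finset.mem_coe.1 hi)).2

theorem IsPermutablyRegular.prod_pow_mem_starSymbolicPower (hf : IsPermutablyRegular n f)
    (hcn : c ≤ n) (hcs : c ≤ s) (hμ : 0 < μ) (hμb : μ ≤ b) (ha : a = b * (s - c) + μ)
    {m v : ℕ} (hv : μ * m ≤ c * v) :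
    ∏ i, f i ^ v ∈ starSymbolicPower (foldProductIdeal a f (fun _ => b)) m := by
  rw [mem_starSymbolicPower_iff]
  intro P hP
  have hPp := hP.1.1
  obtain ⟨T, hT, hTP⟩ := hf.exists_mem_minimalPrimes_span hcn hcs hμ hμb ha hP
  -- The members off `T` are units at `P`; this multiplier fills their exponents up to the cap `m
  -- b`.
  refine ⟨∏ i ∈ Tᶜ, f i ^ (m * b), fun hmem => ?_, ?_⟩
  · obtain ⟨i, hi, hiP⟩ := (Ideal.IsPrime.prod_mem_iff (p := P)).1 hmem
    exact hTP i (Finset.mem_compl.1 hi) (hPp.mem_of_pow_mem _ hiP)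
  have : (∏ i ∈ Tᶜ, f i ^ (m * b)) * ∏ i, f i ^ v =
      ∏ i, f i ^ (v + if i ∈ T then 0 else m * b) := by
    simp only [pow_add, Finset.prod_mul_distrib]
    rw [mul_comm]
    congr 1
    have h1 : ∏ i ∈ T, f i ^ (if i ∈ T then 0 else m * b) = 1 :=
      Finset.prod_eq_one fun i hi => by rw [if_pos hi, pow_zero]
    rw [← Finset.prod_mul_prod_compl T, h1, one_mul]
    exact Finset.prod_congr rfl fun i hi => by rw [if_neg (Finset.mem_compl.1 hi)]
  rw [this]
  apply prod_pow_mem_foldProductIdeal_pow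
  rw [← Finset.sum_add_sum_compl T]
  have h1 : ∑ i ∈ T, min (v + if i ∈ T then 0 else m * b) (m * b) = c * min v (m * b) := by
    rw [Finset.sum_congr rfl (g := fun _ => min v (m * b)) (fun i hi => by simp [hi]),
      Finset.sum_const, hT, smul_eq_mul]
  have h2 : ∑ i ∈ Tᶜ, min (v + if i ∈ T then 0 else m * b) (m * b) = (s - c) * (m * b) := by
    rw [Finset.sum_congr rfl (g := fun _ => m * b) (fun i hi => by
      rw [if_neg (Finset.mem_compl.1 hi)]; simp), Finset.sum_const, Finset.card_compl,
      Fintype.card_fin, hT, smul_eq_mul]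
  have h3 : m * μ ≤ c * min v (m * b) := by
    rcases le_total v (m * b) with h | h
    · rw [min_eq_left h]; linarith
    · rw [min_eq_right h]
      rcases Nat.eq_zero_or_pos c with rfl | hc
      · rw [zero_mul] at hv ⊢; linarith
      · exact (Nat.mul_le_mul_left m hμb).trans (Nat.le_mul_of_pos_left _ hc)
  rw [h1, h2, ha]
  linarith [mul_comm m b, mul_assoc (s - c) m b, show m * (b * (s - c) + μ) = (s - c) * (m * b) + m * μ by ring]

theorem prod_pow_mem_foldProductIdeal_pow_of_lt (f : Fin s → R)
    (hc : 0 < c) (hcs : c ≤ s) (hμb : μ ≤ b) (ha : a = b * (s - c) + μ) {m r : ℕ}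
    (hmr : a * c * r < μ * s * m) {e : Fin s → ℕ}
    (he : ∀ T : Finset (Fin s), T.card = c → μ * m ≤ ∑ i ∈ T, e i) :
    ∏ i, f i ^ e i ∈ foldProductIdeal a f (fun _ => b) ^ r := by
  apply prod_pow_mem_foldProductIdeal_pow
  obtain ⟨T, hT, hmin⟩ := exists_card_eq_forall_le e (c := c) (by simpa using hcs)
  -- If the cap `r b` is inactive on the `c` smallest exponents, averaging suffices. Otherwise at
  -- least `s - c + 1` entries reach it, and `b (s - c + 1) ≥ a`.
  by_cases hlt : ∀ i ∈ T, e i ≤ r * b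
  · have h1 := card_mul_sum_le (fun i => min (e i) (r * b)) T fun i hi l hl =>
      min_le_min_right _ (hmin i hi l hl)
    rw [Finset.sum_congr rfl fun i hi => min_eq_left (hlt i hi), Fintype.card_fin, hT] at h1
    refine le_of_mul_le_mul_left (a := c) ?_ hc
    have h2 := Nat.mul_le_mul_left s (he T hT)
    nlinarith
  · push Not at hlt
    obtain ⟨i, hi, hlt⟩ := hlt
    have hsub : ∀ l ∈ insert i Tᶜ, r * b ≤ min (e l) (r * b) := by
      intro l hl
      rw [Finset.mem_insert, Finset.mem_compl] at hl
      rcases hl with rfl | hl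
      · exact le_min hlt.le le_rfl
      · exact le_min (hlt.le.trans (hmin i hi l hl)) le_rfl
    have h1 := Finset.card_nsmul_le_sum _ _ _ hsub
    rw [Finset.card_insert_of_notMem (by simpa using hi), Finset.card_compl, Fintype.card_fin, hT,
      smul_eq_mul] at h1
    refine le_trans ?_ (h1.trans (Finset.sum_le_sum_of_subset (Finset.subset_univ _)))
    rw [ha]
    nlinarith [Nat.mul_le_mul_left r hμb]

end FoldProducts

/-! ### The Waldschmidt constant and the resurgence -/

section Main

open MvPolynomial

variable {K : Type*} [Field K] {n s a b c d μ : ℕ} {f : Fin s → MvPolynomial (Fin (n + 1)) K}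

theorem IsPermutablyRegular.starSymbolicPower_le (hf : IsPermutablyRegular n f)
    (hdeg : ∀ i, (f i).IsHomogeneous d) (hd : 0 < d) (hs : n + 1 ≤ s)
    (hcn : c ≤ n) (hμ : 0 < μ) (hμb : μ ≤ b) (ha : a = b * (s - c) + μ) (m : ℕ) :
    starSymbolicPower (foldProductIdeal a f (fun _ => b)) m ≤
      productIdeal f {e | ∀ T : Finset (Fin s), T.card = c → μ * m ≤ ∑ i ∈ T, e i} := by
  intro g hg
  rw [mem_starSymbolicPower_iff] at hg
  refine hf.mem_productIdeal_of_forall_mem_pow hcn fun T hT => ?_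
  refine hf.mem_pow_of_forall_minimalPrimes hdeg hd hs T (by omega) fun P hP => ?_
  obtain ⟨u, hu, hug⟩ := hg P
    (hf.mem_minimalPrimes_foldProductIdeal hcn (by omega) hμ hμb ha T hT hP)
  refine ⟨u, hu, ?_⟩
  rw [pow_mul]
  exact Ideal.pow_right_mono (foldProductIdeal_le_span_pow f ha T hT) m hug

theorem le_of_isHomogeneous_of_mem_pow_idealOfVars {σ : Type*} {g : MvPolynomial σ K} {k D : ℕ}
    (hg : g.IsHomogeneous k) (h0 : g ≠ 0) (hmem : g ∈ idealOfVars σ K ^ D) : D ≤ k := by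
  obtain ⟨x, hx⟩ := support_nonempty.2 h0
  have h1 := (mem_pow_idealOfVars_iff _ _).1 hmem x hx
  exact h1.trans (hg.degree_eq_sum_deg_support hx).ge

/-- The witness `g` excludes the default value `0` of the infimum. -/
theorem le_leastDegree {σ : Type*} {J : Ideal (MvPolynomial σ K)} {D : ℕ}
    (hJ : J ≤ idealOfVars σ K ^ D) {g : MvPolynomial σ K} {k : ℕ} (hg : g ∈ J) (h0 : g ≠ 0)
    (hk : g.IsHomogeneous k) : D ≤ leastDegree J := by
  obtain ⟨g', hg', h0', hk'⟩ := Nat.sInf_mem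
    (s := {k | ∃ g ∈ J, g ≠ 0 ∧ g.IsHomogeneous k}) ⟨k, g, hg, h0, hk⟩
  exact le_of_isHomogeneous_of_mem_pow_idealOfVars hk' h0' (hJ hg')

theorem leastDegree_le {σ : Type*} {J : Ideal (MvPolynomial σ K)} {g : MvPolynomial σ K} {k : ℕ}
    (hg : g ∈ J) (h0 : g ≠ 0) (hk : g.IsHomogeneous k) : leastDegree J ≤ k :=
  Nat.sInf_le ⟨g, hg, h0, hk⟩

theorem isHomogeneous_prod_pow (hdeg : ∀ i, (f i).IsHomogeneous d) (e : Fin s → ℕ) :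
    (∏ i, f i ^ e i).IsHomogeneous (d * ∑ i, e i) := by
  rw [Finset.mul_sum]
  exact IsHomogeneous.prod _ _ _ fun i _ => (hdeg i).pow _

theorem IsPermutablyRegular.prod_pow_ne_zero (hf : IsPermutablyRegular n f) (e : Fin s → ℕ) :
    ∏ i, f i ^ e i ≠ 0 := by
  refine Finset.prod_ne_zero_iff.2 fun i _ => pow_ne_zero _ fun h0 => ?_
  have := hf ∅ i (by simp) (by simp) 1 (by simp [h0])
  simp at this

theorem productIdeal_le_pow_idealOfVars (hdeg : ∀ i, (f i).IsHomogeneous d) {A : Set (Fin s → ℕ)}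
    {k : ℕ} (hA : ∀ e ∈ A, k ≤ ∑ i, e i) :
    productIdeal f A ≤ idealOfVars (Fin (n + 1)) K ^ (d * k) := by
  rw [productIdeal, Ideal.span_le]
  rintro _ ⟨e, he, rfl⟩
  exact Ideal.pow_le_pow_right (Nat.mul_le_mul_left d (hA e he))
    (isHomogeneous_prod_pow hdeg e).mem_pow_idealOfVars

theorem foldProductIdeal_le_pow_idealOfVars (hdeg : ∀ i, (f i).IsHomogeneous d) :
    foldProductIdeal a f (fun _ => b) ≤ idealOfVars (Fin (n + 1)) K ^ (d * a) := by
  rw [foldProductIdeal, Ideal.span_le]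
  rintro _ ⟨e, -, rfl, rfl⟩
  exact (isHomogeneous_prod_pow hdeg e).mem_pow_idealOfVars

theorem IsPermutablyRegular.leastDegree_foldProductIdeal (hf : IsPermutablyRegular n f)
    (hdeg : ∀ i, (f i).IsHomogeneous d) (ha : a ≤ b * s) :
    leastDegree (foldProductIdeal a f (fun _ => b)) = d * a := by
  obtain ⟨e, -, heb, hsum⟩ := exists_sum_eq_of_le (l := 0) (u := fun _ : Fin s => b) (a := a)
    (fun _ => Nat.zero_le _) (by simp) (by simpa [mul_comm] using ha)
  have hmem : ∏ i, f i ^ e i ∈ foldProductIdeal a f (fun _ => b) :=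
    Ideal.subset_span ⟨e, heb, hsum, rfl⟩
  have hhom := isHomogeneous_prod_pow hdeg e
  rw [hsum] at hhom
  exact le_antisymm (leastDegree_le hmem (hf.prod_pow_ne_zero e) hhom)
    (le_leastDegree (foldProductIdeal_le_pow_idealOfVars hdeg) hmem (hf.prod_pow_ne_zero e) hhom)

theorem IsPermutablyRegular.leastDegree_starSymbolicPower_le (hf : IsPermutablyRegular n f)
    (hdeg : ∀ i, (f i).IsHomogeneous d)
    (hcn : c ≤ n) (hcs : c ≤ s) (hμ : 0 < μ) (hμb : μ ≤ b) (ha : a = b * (s - c) + μ)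
    {m v : ℕ} (hv : μ * m ≤ c * v) :
    leastDegree (starSymbolicPower (foldProductIdeal a f (fun _ => b)) m) ≤ d * (s * v) := by
  refine leastDegree_le (hf.prod_pow_mem_starSymbolicPower hcn hcs hμ hμb ha hv)
    (hf.prod_pow_ne_zero _) ?_
  simpa using isHomogeneous_prod_pow hdeg fun _ => v

theorem IsPermutablyRegular.le_leastDegree_starSymbolicPower (hf : IsPermutablyRegular n f)
    (hdeg : ∀ i, (f i).IsHomogeneous d) (hd : 0 < d) (hs : n + 1 ≤ s) (hc : 0 < c)
    (hcn : c ≤ n) (hμ : 0 < μ) (hμb : μ ≤ b) (ha : a = b * (s - c) + μ) (m : ℕ) :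
    d * (s * (μ * m)) ≤
      c * leastDegree (starSymbolicPower (foldProductIdeal a f (fun _ => b)) m) := by
  have hle := (hf.starSymbolicPower_le hdeg hd hs hcn hμ hμb ha m).trans
    (productIdeal_le_pow_idealOfVars hdeg (k := (s * (μ * m)) ⌈/⌉ c) fun e he => by
      obtain ⟨T, hT, hmin⟩ := exists_card_eq_forall_le e (c := c) (by simp; omega)
      have h1 := card_mul_sum_le e T hmin
      rw [Fintype.card_fin, hT] at h1
      rw [ceilDiv_le_iff_le_mul hc]
      exact (Nat.mul_le_mul_left s (he T hT)).trans h1)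
  have hv : μ * m ≤ c * (μ * m) := Nat.le_mul_of_pos_left _ hc
  have h1 := le_leastDegree hle (hf.prod_pow_mem_starSymbolicPower hcn (by omega) hμ hμb ha hv)
    (hf.prod_pow_ne_zero _) (isHomogeneous_prod_pow hdeg _)
  calc d * (s * (μ * m)) ≤ d * (c * ((s * (μ * m)) ⌈/⌉ c)) :=
        Nat.mul_le_mul_left d (by simpa using le_smul_ceilDiv (b := s * (μ * m)) hc)
    _ = c * (d * ((s * (μ * m)) ⌈/⌉ c)) := by ring
    _ ≤ _ := Nat.mul_le_mul_left c h1

theorem IsPermutablyRegular.tendsto_starWaldschmidtSeq (hf : IsPermutablyRegular n f)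
    (hdeg : ∀ i, (f i).IsHomogeneous d) (hd : 0 < d) (hs : n + 1 ≤ s) (hc : 0 < c)
    (hcn : c ≤ n) (hμ : 0 < μ) (hμb : μ ≤ b) (ha : a = b * (s - c) + μ) :
    Tendsto (starWaldschmidtSeq (foldProductIdeal a f (fun _ => b))) atTop
      (𝓝 ((d : ℝ) * s * μ / c)) := by
  have hc' : (0 : ℝ) < c := Nat.cast_pos.2 hc
  have hlim : Tendsto (fun m : ℕ => (d : ℝ) * s * μ / c + (d * s : ℝ) / m) atTop
      (𝓝 ((d : ℝ) * s * μ / c)) := by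
    simpa using tendsto_const_nhds.add (tendsto_const_div_atTop_nhds_zero_nat ((d : ℝ) * s))
  refine tendsto_of_tendsto_of_tendsto_of_le_of_le' tendsto_const_nhds hlim ?_ ?_
  · filter_upwards [eventually_gt_atTop 0] with m hm
    have hm' : (0 : ℝ) < m := Nat.cast_pos.2 hm
    have h := hf.le_leastDegree_starSymbolicPower hdeg hd hs hc hcn hμ hμb ha m
    rw [starWaldschmidtSeq, div_le_div_iff₀ hc' hm']
    have h' : (d : ℝ) * (s * (μ * m)) ≤
      c * leastDegree (starSymbolicPower (foldProductIdeal a f (fun _ => b)) m) := by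
        exact_mod_cast h
    linarith
  · filter_upwards [eventually_gt_atTop 0] with m hm
    have hm' : (0 : ℝ) < m := Nat.cast_pos.2 hm
    -- This `v` exceeds `μ m / c` by at most `1`, an error that vanishes after division by `m`.
    have h := hf.leastDegree_starSymbolicPower_le hdeg hcn (by omega) hμ hμb ha (m := m)
      (v := μ * m / c + 1) (Nat.lt_mul_div_succ _ hc).le
    have h' : (leastDegree (starSymbolicPower (foldProductIdeal a f (fun _ => b)) m) : ℝ) ≤
        d * (s * (((μ * m / c : ℕ) : ℝ) + 1)) := by exact_mod_cast h
    have h2 : ((μ * m / c : ℕ) : ℝ) ≤ (μ * m : ℝ) / c := by exact_mod_cast Nat.cast_div_le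
    rw [starWaldschmidtSeq, div_le_iff₀ hm']
    refine h'.trans ?_
    calc (d : ℝ) * (s * (((μ * m / c : ℕ) : ℝ) + 1)) ≤ d * (s * ((μ * m : ℝ) / c + 1)) := by gcongr
      _ = (d * s * μ / c + d * s / m) * m := by field_simp

theorem IsPermutablyRegular.isLUB_starResurgenceSet (hf : IsPermutablyRegular n f)
    (hdeg : ∀ i, (f i).IsHomogeneous d) (hd : 0 < d) (hs : n + 1 ≤ s) (hc : 0 < c)
    (hcn : c ≤ n) (hμ : 0 < μ) (hμb : μ ≤ b) (ha : a = b * (s - c) + μ) :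
    IsLUB (starResurgenceSet (foldProductIdeal a f (fun _ => b))) ((a : ℝ) * c / (μ * s)) := by
  have ha0 : 0 < a := by omega
  have ha' : (0 : ℝ) < a := Nat.cast_pos.2 ha0
  have hc' : (0 : ℝ) < c := Nat.cast_pos.2 hc
  have hμ' : (0 : ℝ) < μ := Nat.cast_pos.2 hμ
  have hs' : (0 : ℝ) < s := Nat.cast_pos.2 (by omega)
  constructor
  · rintro _ ⟨m, r, hm, hr, hnot, rfl⟩
    have hr' : (0 : ℝ) < r := Nat.cast_pos.2 hr
    rw [div_le_div_iff₀ hr' (by positivity)]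
    by_contra! hlt
    have hlt' : a * c * r < μ * s * m := by
      have : (a : ℝ) * c * r < μ * s * m := by linarith
      exact_mod_cast this
    refine hnot ((hf.starSymbolicPower_le hdeg hd hs hcn hμ hμb ha m).trans (Ideal.span_le.2 ?_))
    rintro _ ⟨e, he, rfl⟩
    exact prod_pow_mem_foldProductIdeal_pow_of_lt f hc (by omega) hμb ha hlt' he
  · intro B hB
    have key : ∀ t : ℕ, 0 < t → (c * t : ℝ) ≤ B * (s * μ * t / a + 1) := by
      intro t ht
      have hmem : ((c * t : ℕ) : ℝ) / ((s * μ * t / a + 1 : ℕ) : ℝ) ∈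
          starResurgenceSet (foldProductIdeal a f (fun _ => b)) := by
        -- Here `r` is the least integer with `r a > s μ t`, so `(f₁ ⋯ f_s) ^ (μ t)` has too small a
        -- degree to lie in `I ^ r`.
        refine ⟨c * t, s * μ * t / a + 1, Nat.mul_pos hc ht, Nat.succ_pos _, fun hle => ?_, rfl⟩
        have h1 := hle (hf.prod_pow_mem_starSymbolicPower hcn (by omega) hμ hμb ha
          (v := μ * t) (by apply le_of_eq; ring))
        have h2 := Ideal.pow_right_mono (foldProductIdeal_le_pow_idealOfVars hdeg) _ h1
        rw [← pow_mul] at h2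
        have h3 := le_of_isHomogeneous_of_mem_pow_idealOfVars (isHomogeneous_prod_pow hdeg _)
          (hf.prod_pow_ne_zero _) h2
        rw [mul_assoc] at h3
        have h4 := le_of_mul_le_mul_left h3 hd
        have h5 := Nat.lt_mul_div_succ (s * μ * t) ha0
        simp only [Finset.sum_const, Finset.card_univ, Fintype.card_fin, smul_eq_mul] at h4
        rw [← mul_assoc] at h4
        exact absurd h4 (not_le.2 h5)
      have hle := hB hmem
      have hr : (0 : ℝ) < ((s * μ * t / a + 1 : ℕ) : ℝ) := Nat.cast_pos.2 (Nat.succ_pos _)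
      have hB0 : 0 ≤ B := le_trans (by positivity) hle
      rw [div_le_iff₀ hr] at hle
      push_cast at hle
      refine hle.trans ?_
      gcongr
      exact_mod_cast Nat.cast_div_le
    rw [div_le_iff₀ (by positivity)]
    by_contra! hlt
    -- If `B` were smaller, `key` would bound `t (a c - B μ s)` by `B a`, with positive slope; a
    -- large `t` violates it.
    obtain ⟨t, ht⟩ := exists_nat_gt (max 0 (B * a / (a * c - B * (μ * s))))
    have ht0 : 0 < t := by exact_mod_cast (le_max_left _ _).trans_lt ht
    have h1 := (le_max_right _ _).trans_lt ht
    rw [div_lt_iff₀ (by linarith)] at h1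
    have h2 := mul_le_mul_of_nonneg_right (key t ht0) ha'.le
    have h3 : B * (s * μ * t / a + 1) * a = B * (s * μ * t) + B * a := by field_simp
    rw [h3] at h2
    nlinarith

end Main

/-- The first two conjuncts say that the limit defining the `*`-Waldschmidt constant exists and
that the supremum defining the `*`-resurgence is a genuine least upper bound. -/
theorem mainTheorem9 {K : Type*} [Field K] (n s a b d c₀ μ : ℕ)
    (hn : 0 < n) (ha : 0 < a) (hb : 0 < b) (hs : n + 1 ≤ s)
    (ha_lower : b * (s - n) + 1 ≤ a) (ha_upper : a ≤ s * b)
    (hc₀ : c₀ = s - (a - 1) / b) (hμ : μ = a - b * (s - c₀))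
    (f : Fin s → MvPolynomial (Fin (n + 1)) K)
    (hf_deg : ∀ i, (f i).IsHomogeneous d)
    (hf_gen : IsGenericFamily n f)
    (I : Ideal (MvPolynomial (Fin (n + 1)) K))
    (hI : I = foldProductIdeal a f (fun _ => b)) :
    Tendsto (starWaldschmidtSeq I) atTop (𝓝 (starWaldschmidt I)) ∧
    IsLUB (starResurgenceSet I) (starResurgence I) ∧
    starResurgence I = (leastDegree I : ℝ) / starWaldschmidt I ∧
    (leastDegree I : ℝ) / starWaldschmidt I = ((a : ℝ) * c₀) / ((μ : ℝ) * s) := by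
  have hf := hf_gen.isPermutablyRegular
  have hd : 0 < d := hf_gen.degree_pos hf_deg ⟨0, by omega⟩
  have hq1 : s - n ≤ (a - 1) / b := by
    rw [Nat.le_div_iff_mul_le hb, mul_comm]; omega
  have hq2 : (a - 1) / b < s := by
    rw [Nat.div_lt_iff_lt_mul hb]; omega
  have hq3 : s - c₀ = (a - 1) / b := by omega
  -- The remainder of `a - 1`, rather than of `a`, is `μ - 1`, which places `μ` in `1, …, b`.
  have hdiv := Nat.div_add_mod (a - 1) b
  have hmod := Nat.mod_lt (a - 1) hb
  rw [← hq3] at hdiv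
  have hc : 0 < c₀ := by omega
  have hcn : c₀ ≤ n := by omega
  have hμ0 : 0 < μ := by omega
  have hμb : μ ≤ b := by omega
  have haμ : a = b * (s - c₀) + μ := by omega
  have hlim := hf.tendsto_starWaldschmidtSeq hf_deg hd hs hc hcn hμ0 hμb haμ
  have hlub := hf.isLUB_starResurgenceSet hf_deg hd hs hc hcn hμ0 hμb haμ
  have hdegree := hf.leastDegree_foldProductIdeal hf_deg (ha_upper.trans_eq (mul_comm s b))
  rw [← hI] at hlim hlub hdegree
  have hW : starWaldschmidt I = (d : ℝ) * s * μ / c₀ := hlim.limUnder_eq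
  have hR : starResurgence I = (a : ℝ) * c₀ / (μ * s) := hlub.csSup_eq hlub.nonempty
  have hratio : (leastDegree I : ℝ) / starWaldschmidt I = ((a : ℝ) * c₀) / ((μ : ℝ) * s) := by
    have h1 : (d : ℝ) ≠ 0 := by exact_mod_cast hd.ne'
    have h2 : (c₀ : ℝ) ≠ 0 := by exact_mod_cast hc.ne'
    have h3 : (μ : ℝ) ≠ 0 := by exact_mod_cast hμ0.ne'
    have h4 : (s : ℝ) ≠ 0 := by exact_mod_cast (by omega : s ≠ 0)
    rw [hdegree, hW]
    push_cast
    field_simp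
  exact ⟨hW ▸ hlim, hR ▸ hlub, hR.trans hratio.symm, hratio⟩
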